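/- Let $v_1,\dots,v_m\in\mathbb{Z}^n$ and let $$Z=\sum_{j=1}^m[0,v_j]=\Big\{\sum_{j=1}^m\mu_jv_j:\ 0\le\mu_j\le1\Big\}\subset\mathbb{R}^n$$ be the lattice zonotope generated by them. For $k\in\mathbb{N}=\{0,1,2,\dots\}$, the number of lattice points $\#(kZ\cap\mathbb{Z}^n)$ is a polynomial in $k$ of degree at most $n$, the Ehrhart polynomial of $Z$; write $$\#(kZ\cap\mathbb{Z}^n)=\sum_{i=0}^n \mathrm{g}_i(Z)\,k^i .$$ For $J\subseteq\{1,\dots,m\}$ let $P_J=\sum_{j\in J}[0,v_j]$, let $\mathrm{lin}\,P_J$ be its linear hull, let $\mathrm{vol}_i$ denote $i$-dimensional volume (so that $\mathrm{vol}_i(P_J)=0$ if $\dim P_J<i$), and let $\det(\mathrm{lin}\,P_J\cap\mathbb{Z}^n)$ be the determinant of the lattice $\mathrm{lin}\,P_J\cap\mathbb{Z}^n$, i.e. the volume, in its linear hull $\mathrm{lin}\,P_J$, of a fundamental parallelepiped of this lattice (equal to $1$ if $\mathrm{lin}\,P_J=\{0\}$). Then for every $1\le i\le n$ $$\mathrm{g}_i(Z)=\sum_{J\subseteq\{1,\dots,m\},\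 \#J=i}\frac{\mathrm{vol}_i(P_J)}{\det(\mathrm{lin}\,P_J\cap\mathbb{Z}^n)} .$$ -/

import Mathlib

open MeasureTheory Polynomial
open scoped Pointwise

noncomputable section

namespace LatticeZonotope

/-- The integer lattice `ℤⁿ` in Euclidean space `ℝⁿ`: the `ℤ`-span of the standard basis. -/
def integerLattice (n : ℕ) : Submodule ℤ (EuclideanSpace ℝ (Fin n)) :=
  Submodule.span ℤ (Set.range (EuclideanSpace.basisFun (Fin n) ℝ).toBasis)

theorem mem_integerLattice {n : ℕ} (x : EuclideanSpace ℝ (Fin n)) :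
    x ∈ integerLattice n ↔ ∀ i, ∃ z : ℤ, x i = z := by
  unfold integerLattice
  rw [Module.Basis.mem_span_iff_repr_mem]
  simp [eq_comm]

/-- The zonotope `∑_{j ∈ J} [0, v_j]`, a Minkowski sum of segments (`{0}` if `J` is empty). -/
def zonotope {n m : ℕ} (v : Fin m → EuclideanSpace ℝ (Fin n)) (J : Finset (Fin m)) :
    Set (EuclideanSpace ℝ (Fin n)) :=
  ∑ j ∈ J, segment ℝ 0 (v j)

/-- The lattice point enumerator `G(K) = #(K ∩ ℤⁿ)`. -/
def latticePointCount {n : ℕ} (K : Set (EuclideanSpace ℝ (Fin n))) : ℕ :=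
  (K ∩ (integerLattice n : Set (EuclideanSpace ℝ (Fin n)))).ncard

/-- `p` is the Ehrhart polynomial of `P ⊆ ℝⁿ`: it has degree at most `n`, and
`G(k P) = p(k)` for every `k ∈ ℕ`. -/
structure IsEhrhartPolynomial {n : ℕ} (P : Set (EuclideanSpace ℝ (Fin n))) (p : ℝ[X]) : Prop where
  natDegree_le : p.natDegree ≤ n
  count_eq : ∀ k : ℕ, (latticePointCount ((k : ℝ) • P) : ℝ) = p.eval (k : ℝ)

theorem IsEhrhartPolynomial.unique {n : ℕ} {P : Set (EuclideanSpace ℝ (Fin n))} {p q : ℝ[X]}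
    (hp : IsEhrhartPolynomial P p) (hq : IsEhrhartPolynomial P q) : p = q := by
  refine Polynomial.eq_of_infinite_eval_eq p q
    ((Set.infinite_range_of_injective (Nat.cast_injective (R := ℝ))).mono ?_)
  rintro _ ⟨k, rfl⟩
  exact (hp.count_eq k).symm.trans (hq.count_eq k)

open Classical in
/-- The Ehrhart polynomial of `P` (with the value `0` if `P` has none). -/
def ehrhartPolynomial {n : ℕ} (P : Set (EuclideanSpace ℝ (Fin n))) : ℝ[X] :=
  if h : ∃ p, IsEhrhartPolynomial P p then h.choose else 0

/-- The `i`-th Ehrhart coefficient `g_i(P)`. -/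
def ehrhartCoeff {n : ℕ} (i : ℕ) (P : Set (EuclideanSpace ℝ (Fin n))) : ℝ :=
  (ehrhartPolynomial P).coeff i

/-- The `i`-dimensional volume `vol_i` of a subset of `ℝⁿ`: the `i`-dimensional Hausdorff measure,
normalized so that it is Lebesgue measure on every `i`-dimensional linear subspace. -/
def vol {n : ℕ} (i : ℕ) (S : Set (EuclideanSpace ℝ (Fin n))) : ℝ :=
  (μHE[i] S).toReal

/-- The determinant of a (not necessarily full-dimensional) lattice `Λ` in `ℝⁿ`: the volume of a
fundamental domain of `Λ` in its linear hull, with respect to the Lebesgue measure that the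
Euclidean inner product induces on that hull. -/
def latticeDet {n : ℕ} (Λ : Submodule ℤ (EuclideanSpace ℝ (Fin n))) : ℝ :=
  ZLattice.covolume
    (ZLattice.comap ℝ Λ (Submodule.span ℝ (Λ : Set (EuclideanSpace ℝ (Fin n)))).subtype)

/-- The lattice `lin S ∩ ℤⁿ`, where `lin S` is the linear hull of `S`. -/
def linLattice {n : ℕ} (S : Set (EuclideanSpace ℝ (Fin n))) :
    Submodule ℤ (EuclideanSpace ℝ (Fin n)) :=
  (Submodule.span ℝ S).restrictScalars ℤ ⊓ integerLattice n

end LatticeZonotope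

end

noncomputable section

/-! Adding a segment `[0, v]` to a convex set `S` creates exactly one new lattice point in each
coset `g + ℤv` whose real line meets `S` boundedly. So the points gained are counted by the cosets
modulo `ℤv` met by `S + ℝv`: a deletion–contraction rule, `classCount_add_segment`, valid modulo any
subgroup `H` that preserves `S`. Iterating over the generators leaves one term per linearly
independent `J`: the number of lattice points of `lin P_J` modulo `ℤ v_J`, a lattice index.
Comparing covolumes turns it into `vol / det`; for dependent `J` the volume vanishes. Replacing `v`
by `kv` multiplies the `J`-term by `k ^ #J`, so the count is a polynomial whose coefficients can be
read off. -/

namespace LatticeZonotope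

/-! ### Deletion and contraction for one segment. -/

section Classes

variable {E : Type*} [AddCommGroup E] [Module ℝ E]

/-- The number of classes modulo `H` of the points of `L` that lie in `S`. -/
def classCount (L H : Submodule ℤ E) (S : Set E) : ℕ∞ :=
  (H.mkQ '' ((L : Set E) ∩ S)).encard

theorem mem_add_segment {S : Set E} {v y : E} :
    y ∈ S + segment ℝ 0 v ↔ ∃ t : ℝ, 0 ≤ t ∧ t ≤ 1 ∧ y - t • v ∈ S := by
  rw [segment_eq_image']
  constructor
  · rintro ⟨s, hs, _, ⟨t, ht, rfl⟩, rfl⟩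
    exact ⟨t, ht.1, ht.2, by simpa using hs⟩
  · rintro ⟨t, h0, h1, hs⟩
    exact ⟨_, hs, _, ⟨t, ⟨h0, h1⟩, rfl⟩, by simp⟩

/-- Otherwise `y` would lie between two points of `S`. -/
theorem add_smul_notMem_of_convex {S : Set E} (hS : Convex ℝ S) {v y : E} (hy : y ∉ S)
    {t : ℝ} (ht : 0 ≤ t) (hyt : y - t • v ∈ S) {r : ℝ} (hr : 0 ≤ r) : y + r • v ∉ S := by
  intro hyr
  rcases ht.eq_or_lt with rfl | ht
  · simp at hyt
    exact hy hyt
  have hpos : 0 < t + r := by linarith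
  apply hy
  have := hS hyt hyr (a := r / (t + r)) (b := t / (t + r)) (by positivity) (by positivity)
    (by field_simp; ring)
  convert this using 1
  have h1 : y = (r / (t + r) + t / (t + r)) • y := by
    rw [← add_div, add_comm r t, div_self hpos.ne', one_smul]
  have h2 : (r / (t + r)) * t = t / (t + r) * r := by ring
  nth_rewrite 1 [h1]
  rw [smul_sub, smul_add, smul_smul, smul_smul, h2, add_smul]
  abel

variable {L H : Submodule ℤ E} {S : Set E} {v : E}

/-- Take the least integer exceeding every parameter at which the line is in `S`; by minimality `S`
is met at most one step below it. -/
theorem exists_top_point {g : E} (hb : BddAbove {t : ℝ | g + t • v ∈ S})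
    {r : ℝ} (hr : g + r • v ∈ S) :
    ∃ n : ℤ, g + n • v ∉ S ∧ g + n • v ∈ S + segment ℝ 0 v := by
  obtain ⟨B, hB⟩ := hb
  obtain ⟨n, hn, hmin⟩ := Int.exists_least_of_bdd
    (P := fun n : ℤ => ∀ t : ℝ, g + t • v ∈ S → t < n)
    ⟨⌊r⌋, fun z hz => Int.floor_le_iff.2 (by have := hz r hr; linarith)⟩
    ⟨⌊B⌋ + 1, fun t ht => (hB ht).trans_lt (by push_cast; exact Int.lt_floor_add_one B)⟩
  have hns : ¬ ∀ t : ℝ, g + t • v ∈ S → t < ((n - 1 : ℤ) : ℝ) := fun h => by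
    have := hmin _ h
    omega
  push Not at hns
  obtain ⟨t, ht, hnt⟩ := hns
  push_cast at hnt
  refine ⟨n, fun h => ?_, ?_⟩
  · rw [← Int.cast_smul_eq_zsmul ℝ] at h
    exact lt_irrefl _ (hn _ h)
  · rw [mem_add_segment]
    refine ⟨n - t, by linarith [hn t ht], by linarith, ?_⟩
    rw [← Int.cast_smul_eq_zsmul ℝ, sub_smul]
    convert ht using 1
    abel

/-- By convexity `S` has no points beyond either top point, yet each is within one step of `S`; this
forces `-1 < n < 1`. -/
theorem top_point_unique (hS : Convex ℝ S) {g : E} {n : ℤ}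
    (h1 : g ∉ S) (h1' : g ∈ S + segment ℝ 0 v)
    (h2 : g + n • v ∉ S) (h2' : g + n • v ∈ S + segment ℝ 0 v) : n = 0 := by
  rw [mem_add_segment] at h1' h2'
  obtain ⟨t, ht0, ht1, ht⟩ := h1'
  obtain ⟨s, hs0, hs1, hs⟩ := h2'
  rw [← Int.cast_smul_eq_zsmul ℝ] at h2 hs
  have ha : (n : ℝ) - s < 0 := by
    by_contra! hc
    apply add_smul_notMem_of_convex hS h1 ht0 ht hc
    convert hs using 1
    rw [sub_smul]
    abel
  have hb : -t - (n : ℝ) < 0 := by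
    by_contra! hc
    apply add_smul_notMem_of_convex hS h2 hs0 hs hc
    convert ht using 1
    rw [sub_smul, neg_smul]
    abel
  have h3 : (n : ℝ) < 1 := by linarith
  have h4 : (-1 : ℝ) < n := by linarith
  have h5 : n < 1 := by exact_mod_cast h3
  have h6 : -1 < n := by exact_mod_cast h4
  omega

/-- Deletion and contraction for the number of lattice points of `S + [0, v]`. -/
theorem classCount_add_segment (hS : Convex ℝ S)
    (hHS : ∀ s ∈ S, ∀ h ∈ H, s + h ∈ S) (hv : v ∈ L)
    (hb : ∀ g, BddAbove {t : ℝ | g + t • v ∈ S}) :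
    classCount L H (S + segment ℝ 0 v) = classCount L H S +
      classCount L (H ⊔ Submodule.span ℤ {v}) (S + (Submodule.span ℝ {v} : Set E)) := by
  set H' := H ⊔ Submodule.span ℤ {v} with hH'
  have hHS' : ∀ s ∈ S + segment ℝ 0 v, ∀ h ∈ H, s + h ∈ S + segment ℝ 0 v := by
    intro s hs h hh
    rw [mem_add_segment] at hs ⊢
    obtain ⟨t, h0, h1, ht⟩ := hs
    refine ⟨t, h0, h1, ?_⟩
    convert hHS _ ht h hh using 1
    abel
  have hsub : S ⊆ S + segment ℝ 0 v := fun s hs =>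
    mem_add_segment.2 ⟨0, le_rfl, zero_le_one, by simpa using hs⟩
  have hsplit : H.mkQ '' ((L : Set E) ∩ (S + segment ℝ 0 v)) =
      H.mkQ '' ((L : Set E) ∩ S) ∪ H.mkQ '' ((L : Set E) ∩ ((S + segment ℝ 0 v) \ S)) := by
    rw [← Set.image_union, ← Set.inter_union_distrib_left, Set.union_sdiff_cancel hsub]
  have hdisj : Disjoint (H.mkQ '' ((L : Set E) ∩ S))
      (H.mkQ '' ((L : Set E) ∩ ((S + segment ℝ 0 v) \ S))) := by
    rw [Set.disjoint_left]
    rintro _ ⟨x, ⟨-, hx⟩, rfl⟩ ⟨y, ⟨-, -, hy⟩, hxy⟩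
    have hmem : y - x ∈ H := (Submodule.Quotient.eq H).1 hxy
    exact hy (by simpa using hHS x hx _ hmem)
  have hle : H ≤ H' := le_sup_left
  -- The new points, modulo `H`, biject with the classes of the contraction: existence of top points
  -- gives surjectivity, uniqueness gives injectivity.
  have himg : Submodule.factor hle '' (H.mkQ '' ((L : Set E) ∩ ((S + segment ℝ 0 v) \ S))) =
      H'.mkQ '' ((L : Set E) ∩ (S + (Submodule.span ℝ {v} : Set E))) := by
    rw [Set.image_image]
    apply Set.Subset.antisymm
    · rintro _ ⟨x, ⟨hxL, hx, -⟩, rfl⟩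
      refine ⟨x, ⟨hxL, ?_⟩, rfl⟩
      obtain ⟨t, -, -, ht⟩ := mem_add_segment.1 hx
      exact ⟨_, ht, t • v, Submodule.smul_mem _ _ (Submodule.mem_span_singleton_self v), by simp⟩
    · rintro _ ⟨x, ⟨hxL, s, hs, w, hw, rfl⟩, rfl⟩
      obtain ⟨r, rfl⟩ := Submodule.mem_span_singleton.1 hw
      obtain ⟨n, hn, hn'⟩ := exists_top_point (hb (s + r • v)) (r := -r) (by simpa using hs)
      refine ⟨s + r • v + n • v, ⟨L.add_mem hxL (L.smul_mem n hv), hn', hn⟩, ?_⟩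
      refine (Submodule.Quotient.eq H').2 ?_
      change s + r • v + n • v - (s + r • v) ∈ H'
      rw [add_sub_cancel_left]
      exact Submodule.mem_sup_right (Submodule.smul_mem _ _ (Submodule.mem_span_singleton_self v))
  have hinj : Set.InjOn (Submodule.factor hle)
      (H.mkQ '' ((L : Set E) ∩ ((S + segment ℝ 0 v) \ S))) := by
    rintro _ ⟨x, ⟨hxL, hx, hx'⟩, rfl⟩ _ ⟨y, ⟨hyL, hy, hy'⟩, rfl⟩ hxy
    have hmem : x - y ∈ H' := (Submodule.Quotient.eq H').1 hxy
    obtain ⟨h, hh, w, hw, hsum⟩ := Submodule.mem_sup.1 hmem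
    obtain ⟨n, rfl⟩ := Submodule.mem_span_singleton.1 hw
    have hx_eq : x = y + h + n • v := by rw [add_assoc, hsum]; abel
    have hyh : y + h ∉ S := fun hc => hy' (by simpa using hHS _ hc _ (H.neg_mem hh))
    rw [hx_eq] at hx hx'
    obtain rfl := top_point_unique hS hyh (hHS' y hy h hh) hx' hx
    refine (Submodule.Quotient.eq H).2 ?_
    rw [← hsum]
    simpa using hh
  unfold classCount
  rw [hsplit, Set.encard_union_eq hdisj, ← himg, hinj.encard_image]

end Classes

/-! ### Induction over the generators. -/

section Sum

variable {E : Type*} [AddCommGroup E] [Module ℝ E] {ι : Type*}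

theorem convex_sum_segment (v : ι → E) (K : Finset ι) :
    Convex ℝ (∑ j ∈ K, segment ℝ 0 (v j)) := by
  classical
  induction K using Finset.induction_on with
  | empty => exact convex_singleton (𝕜 := ℝ) (0 : E)
  | insert j K hj ih => rw [Finset.sum_insert hj]; exact (convex_segment (0 : E) (v j)).add ih

theorem bddAbove_image_sum_segment (v : ι → E) (K : Finset ι) (f : E →ₗ[ℝ] ℝ) :
    BddAbove (f '' ∑ j ∈ K, segment ℝ 0 (v j)) := by
  classical
  induction K using Finset.induction_on with
  | empty => simp
  | insert j K hj ih =>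
    rw [Finset.sum_insert hj, Set.image_add]
    refine BddAbove.add ?_ ih
    refine ⟨|f (v j)|, ?_⟩
    rintro _ ⟨x, hx, rfl⟩
    rw [segment_eq_image'] at hx
    obtain ⟨t, ht, rfl⟩ := hx
    simp only [zero_add, sub_zero, map_smul, smul_eq_mul]
    calc t * f (v j) ≤ t * |f (v j)| := mul_le_mul_of_nonneg_left (le_abs_self _) ht.1
      _ ≤ _ := mul_le_of_le_one_left (abs_nonneg _) ht.2

/-- A functional that kills `P` but not `w` is bounded on the zonotope and so bounds `t`. -/
theorem bddAbove_line_sum_segment_add (v : ι → E) (K : Finset ι) (P : Submodule ℝ E) {w : E}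
    (hw : w ∉ P) (g : E) :
    BddAbove {t : ℝ | g + t • w ∈ ∑ j ∈ K, segment ℝ 0 (v j) + (P : Set E)} := by
  obtain ⟨f, hf, hP⟩ := Submodule.exists_le_ker_of_notMem hw
  obtain ⟨B, hB⟩ := bddAbove_image_sum_segment v K ((f w)⁻¹ • f)
  refine ⟨B - (f w)⁻¹ * f g, ?_⟩
  rintro t ⟨z, hz, p, hp, hzp⟩
  have h1 : (f w)⁻¹ * f z ≤ B := hB ⟨z, hz, rfl⟩
  have h2 : f p = 0 := hP hp
  have h3 : f z + f p = f g + t * f w := by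
    rw [← map_add, ← smul_eq_mul, ← map_smul, ← map_add]
    exact congrArg f hzp
  rw [h2, add_zero] at h3
  rw [h3, mul_add, mul_left_comm, inv_mul_cancel₀ hf] at h1
  linarith

theorem submodule_add_segment (P : Submodule ℝ E) {w : E} (hw : w ∈ P) :
    (P : Set E) + segment ℝ 0 w = P := by
  ext y
  rw [mem_add_segment]
  constructor
  · rintro ⟨t, -, -, h⟩
    simpa using P.add_mem h (P.smul_mem t hw)
  · exact fun h => ⟨0, le_rfl, zero_le_one, by simpa using h⟩

open Classical in
/-- The lattice points of a zonotope, counted modulo independent generators `v_j`, `j ∈ A`. -/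
theorem classCount_sum_segment_add_span (L : Submodule ℤ E) (v : ι → E) (hv : ∀ j, v j ∈ L)
    (K : Finset ι) : ∀ A : Finset ι, Disjoint A K → LinearIndepOn ℝ v (A : Set ι) →
    classCount L (Submodule.span ℤ (v '' A))
        (∑ j ∈ K, segment ℝ 0 (v j) + (Submodule.span ℝ (v '' A) : Set E)) =
      ∑ J ∈ K.powerset, if LinearIndepOn ℝ v ((A ∪ J : Finset ι) : Set ι) then
        classCount L (Submodule.span ℤ (v '' (A ∪ J : Finset ι)))
          (Submodule.span ℝ (v '' (A ∪ J : Finset ι))) else 0 := by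
  -- `A` stays general because contraction moves `j` from `K` into `A`.
  induction K using Finset.induction_on with
  | empty =>
    intro A _ hA
    simp [hA]
  | insert j K hj ih =>
    intro A hd hA
    rw [Finset.disjoint_insert_right] at hd
    have hset : ∑ i ∈ insert j K, segment ℝ 0 (v i) + (Submodule.span ℝ (v '' A) : Set E) =
        (∑ i ∈ K, segment ℝ 0 (v i) + (Submodule.span ℝ (v '' A) : Set E)) +
          segment ℝ 0 (v j) := by
      rw [Finset.sum_insert hj, add_assoc, add_comm]
    have hun : ∀ J : Finset ι, A ∪ insert j J = insert j A ∪ J := fun J => by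
      rw [Finset.union_insert, Finset.insert_union]
    rw [Finset.sum_powerset_insert hj, hset]
    by_cases hj' : v j ∈ Submodule.span ℝ (v '' A)
    -- The segment is absorbed by the span, and every index set containing `A` and `j` is dependent.
    · rw [add_assoc, submodule_add_segment _ hj', ih A hd.2 hA]
      convert (add_zero _).symm using 2
      refine Finset.sum_eq_zero fun J _ => ?_
      rw [if_neg]
      intro hli
      have : LinearIndepOn ℝ v (insert j (A : Set ι)) := hli.mono (by
        rw [hun]; push_cast; exact Set.subset_union_left)
      exact (linearIndepOn_insert (by exact_mod_cast hd.1)).1 this |>.2 hj'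
    · have hA' : LinearIndepOn ℝ v ((insert j A : Finset ι) : Set ι) := by
        push_cast
        exact (linearIndepOn_insert (by exact_mod_cast hd.1)).2 ⟨hA, hj'⟩
      have hd' : Disjoint (insert j A) K := Finset.disjoint_insert_left.2 ⟨hj, hd.2⟩
      rw [classCount_add_segment ((convex_sum_segment v K).add (Submodule.convex _)) ?_ (hv j)
        (bddAbove_line_sum_segment_add v K _ hj'), ih A hd.2 hA]
      · congr 1
        simp_rw [hun]
        rw [← ih _ hd' hA']
        have e1 : Submodule.span ℤ (v '' A) ⊔ Submodule.span ℤ {v j} =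
            Submodule.span ℤ (v '' (insert j A : Finset ι)) := by
          rw [← Submodule.span_union, Finset.coe_insert, Set.image_insert_eq, Set.union_singleton]
        have e2 : (Submodule.span ℝ (v '' A) : Set E) + (Submodule.span ℝ {v j} : Set E) =
            (Submodule.span ℝ (v '' (insert j A : Finset ι)) : Set E) := by
          rw [← Submodule.coe_sup, ← Submodule.span_union, Finset.coe_insert, Set.image_insert_eq,
            Set.union_singleton]
        rw [e1, add_assoc, e2]
      · rintro _ ⟨z, hz, p, hp, rfl⟩ h hh
        refine ⟨z, hz, p + h, Submodule.add_mem _ hp ?_, (add_assoc _ _ _).symm⟩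
        exact Submodule.span_subset_span ℤ ℝ _ hh

open Classical in
theorem encard_inter_sum_segment (L : Submodule ℤ E) (v : ι → E) (hv : ∀ j, v j ∈ L)
    (K : Finset ι) :
    ((L : Set E) ∩ ∑ j ∈ K, segment ℝ 0 (v j)).encard =
      ∑ J ∈ K.powerset, if LinearIndepOn ℝ v (J : Set ι) then
        classCount L (Submodule.span ℤ (v '' J)) (Submodule.span ℝ (v '' J)) else 0 := by
  have h := classCount_sum_segment_add_span L v hv K ∅ (Finset.disjoint_empty_left K)
    (by simp)
  simp only [Finset.coe_empty, Set.image_empty, Submodule.span_empty, Submodule.bot_coe,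
    Finset.empty_union, Set.singleton_zero, add_zero] at h
  rw [← h, classCount, Function.Injective.encard_image]
  rw [← LinearMap.ker_eq_bot, Submodule.ker_mkQ]

end Sum

/-- Both sides count the image of `W ∩ L` in `E ⧸ H`. Nonvanishing excludes an infinite image, where
`relIndex` defaults to `0`. -/
theorem classCount_eq_relIndex {E : Type*} [AddCommGroup E] [Module ℝ E] (L H : Submodule ℤ E)
    (W : Submodule ℝ E)
    (h : H.toAddSubgroup.relIndex (W.restrictScalars ℤ ⊓ L).toAddSubgroup ≠ 0) :
    classCount L H W = H.toAddSubgroup.relIndex (W.restrictScalars ℤ ⊓ L).toAddSubgroup := by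
  have hker : H.toAddSubgroup = H.mkQ.toAddMonoidHom.ker := by
    ext x
    simp [AddMonoidHom.mem_ker]
  have hcoe : (AddSubgroup.map H.mkQ.toAddMonoidHom (W.restrictScalars ℤ ⊓ L).toAddSubgroup :
      Set (E ⧸ H)) = H.mkQ '' ((L : Set E) ∩ W) := by
    rw [Set.inter_comm]
    rfl
  have hcard : H.toAddSubgroup.relIndex (W.restrictScalars ℤ ⊓ L).toAddSubgroup =
      (H.mkQ '' ((L : Set E) ∩ W)).ncard := by
    nth_rewrite 1 [hker]
    rw [AddSubgroup.relIndex_ker, ← hcoe]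
    rfl
  rw [hcard] at h ⊢
  exact (Set.finite_of_ncard_ne_zero h).cast_ncard_eq.symm

/-! ### Lattice index as volume over determinant. -/

variable {n m : ℕ}

theorem span_zonotope (v : Fin m → EuclideanSpace ℝ (Fin n)) (J : Finset (Fin m)) :
    Submodule.span ℝ (zonotope v J) = Submodule.span ℝ (v '' J) := by
  apply le_antisymm
  · rw [Submodule.span_le]
    intro x hx
    obtain ⟨g, hg, rfl⟩ := (Set.mem_finsetSum J _ x).1 hx
    refine Submodule.sum_mem _ fun j hj => ?_
    have := @hg j hj
    rw [segment_eq_image'] at this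
    obtain ⟨t, -, ht⟩ := this
    rw [← ht]
    simpa using Submodule.smul_mem _ t (Submodule.subset_span (Set.mem_image_of_mem v hj))
  · rw [Submodule.span_le]
    rintro _ ⟨j, hj, rfl⟩
    classical
    refine Submodule.subset_span ((Set.mem_finsetSum J _ _).2
      ⟨fun i => if i = j then v j else 0, ?_, ?_⟩)
    · intro i hi
      by_cases h : i = j
      · subst h
        simpa using right_mem_segment ℝ 0 (v i)
      · simpa [h] using left_mem_segment ℝ 0 (v i)
    · have hj' : j ∈ J := hj
      simp [hj']

/-- Independent lattice vectors span a sublattice of index `vol(P) / det`. -/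
theorem relIndex_eq_vol_div_latticeDet (v : Fin m → EuclideanSpace ℝ (Fin n))
    (hv : ∀ j, v j ∈ integerLattice n) (J : Finset (Fin m))
    (hJ : LinearIndepOn ℝ v (J : Set (Fin m))) :
    (Submodule.span ℤ (v '' J)).toAddSubgroup.relIndex (linLattice (zonotope v J)).toAddSubgroup
        ≠ 0 ∧
      ((Submodule.span ℤ (v '' J)).toAddSubgroup.relIndex
        (linLattice (zonotope v J)).toAddSubgroup : ℝ) =
      vol J.card (zonotope v J) / latticeDet (linLattice (zonotope v J)) := by
  set M := linLattice (zonotope v J) with hM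
  set W := Submodule.span ℝ (v '' J) with hW
  have hvM : ∀ j ∈ J, v j ∈ M := fun j hj => Submodule.mem_inf.2
    ⟨by
      rw [Submodule.restrictScalars_mem, span_zonotope]
      exact Submodule.subset_span (Set.mem_image_of_mem v hj), hv j⟩
  have hMW : Submodule.span ℝ (M : Set (EuclideanSpace ℝ (Fin n))) = W := by
    apply le_antisymm
    · rw [Submodule.span_le]
      intro x hx
      have := (Submodule.mem_inf.1 hx).1
      rwa [Submodule.restrictScalars_mem, span_zonotope] at this
    · rw [hW, Submodule.span_le]
      rintro _ ⟨j, hj, rfl⟩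
      exact Submodule.subset_span (hvM j hj)
  unfold latticeDet
  -- Covolumes are compared inside `U`, where both lattices have full rank.
  set U := Submodule.span ℝ (M : Set (EuclideanSpace ℝ (Fin n))) with hU
  have hMU : M ≤ U.restrictScalars ℤ := Submodule.subset_span
  let u : J → U := fun j => ⟨v j, hMU (hvM j j.2)⟩
  have hrange : U.subtype '' Set.range u = v '' J := by
    rw [← Set.range_comp]
    ext x
    simp [u]
  have hu : LinearIndependent ℝ u := LinearIndependent.of_comp U.subtype hJ
  have hspan : ⊤ ≤ Submodule.span ℝ (Set.range u) := by
    rw [← Submodule.map_le_map_iff_of_injective U.injective_subtype, Submodule.map_span, hrange,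
      Submodule.map_top, Submodule.range_subtype, hMW]
  let b : Module.Basis J ℝ U := Module.Basis.mk hu hspan
  have hb : ⇑b = u := Module.Basis.coe_mk hu hspan
  let L₁ : Submodule ℤ U := Submodule.span ℤ (Set.range b)
  let L₂ : Submodule ℤ U := ZLattice.comap ℝ M U.subtype
  have hmap : L₁.map (U.subtype.restrictScalars ℤ) = Submodule.span ℤ (v '' J) := by
    rw [Submodule.map_span, hb]
    exact congrArg _ hrange
  have hle : L₁ ≤ L₂ := by
    rw [Submodule.span_le, hb]
    rintro _ ⟨j, rfl⟩
    exact hvM j j.2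
  have hdisc : DiscreteTopology (integerLattice n) := by
    unfold integerLattice
    infer_instance
  have hMdisc : DiscreteTopology M :=
    DiscreteTopology.of_subset hdisc (Set.inter_subset_right)
  have : DiscreteTopology L₂ :=
    ZLattice.comap_discreteTopology ℝ M U.subtype.continuous_of_finiteDimensional
      U.injective_subtype
  have : IsZLattice ℝ L₂ := ⟨by
    rw [eq_top_iff, ← (inferInstance : IsZLattice ℝ L₁).span_top]
    exact Submodule.span_mono hle⟩
  have hindex : L₁.toAddSubgroup.relIndex L₂.toAddSubgroup =
      (Submodule.span ℤ (v '' J)).toAddSubgroup.relIndex M.toAddSubgroup := by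
    rw [← AddSubgroup.relIndex_map_map_of_injective L₁.toAddSubgroup L₂.toAddSubgroup
      (f := U.subtype.toAddMonoidHom) U.injective_subtype, ← hmap]
    congr 1
    ext x
    constructor
    · rintro ⟨y, hy, rfl⟩
      exact hy
    · intro hx
      exact ⟨⟨x, hMU hx⟩, hx, rfl⟩
  have hcard : Module.finrank ℝ U = J.card := by
    rw [Module.finrank_eq_card_basis b, Fintype.card_coe]
  have hvol : ZLattice.covolume L₁ = vol J.card (zonotope v J) := by
    rw [ZLattice.covolume_eq_measure_fundamentalDomain L₁ volume
      (ZSpan.isAddFundamentalDomain b volume),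
      measureReal_congr (ZSpan.fundamentalDomain_ae_parallelepiped b volume)]
    -- The inclusion of `U` is an isometry, so it carries the volume of the fundamental
    -- parallelepiped to that of the zonotope.
    have himage : zonotope v J = U.subtype '' parallelepiped b := by
      rw [parallelepiped_eq_sum_segment, Set.image_finsetSum, zonotope, ← Finset.sum_coe_sort, hb]
      refine Finset.sum_congr rfl fun j _ => ?_
      refine Eq.trans ?_ (image_segment ℝ U.subtype.toAffineMap 0 (u j)).symm
      simp [u]
    rw [vol, himage, ← hcard, ← InnerProductSpace.euclideanHausdorffMeasure_eq_volume]
    exact congrArg ENNReal.toReal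
      (isometry_subtype_coe.euclideanHausdorffMeasure_image (parallelepiped b)).symm
  have key := ZLattice.covolume_div_covolume_eq_relIndex' L₁ L₂ hle
  rw [hindex, hvol] at key
  refine ⟨?_, key.symm⟩
  rw [← Nat.cast_ne_zero (R := ℝ), ← key, ← hvol]
  exact div_ne_zero (ZLattice.covolume_ne_zero _ _) (ZLattice.covolume_ne_zero _ _)

/-- The zonotope lies in a subspace of dimension below `#J`, on which `#J`-dimensional Hausdorff
measure is zero. -/
theorem vol_zonotope_of_not_linearIndepOn (v : Fin m → EuclideanSpace ℝ (Fin n))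
    (J : Finset (Fin m)) (hJ : ¬ LinearIndepOn ℝ v (J : Set (Fin m))) :
    vol J.card (zonotope v J) = 0 := by
  classical
  set W := Submodule.span ℝ (v '' J) with hW
  have hlt : Module.finrank ℝ W < J.card := by
    refine lt_of_le_of_ne ?_ fun h => hJ ?_
    · rw [hW, ← Finset.coe_image]
      exact (finrank_span_finset_le_card _).trans Finset.card_image_le
    · refine linearIndependent_iff_card_eq_finrank_span.2 ?_
      rw [Set.finrank, ← Nat.card_eq_fintype_card, Nat.card_coe_set_eq, Set.ncard_coe_finset, ← h, hW,
        Set.image_eq_range]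
  have hsub : zonotope v J ⊆ Subtype.val '' (Set.univ : Set W) := fun x hx => by
    have : x ∈ W := by
      rw [hW, ← span_zonotope]
      exact Submodule.subset_span hx
    exact ⟨⟨x, this⟩, trivial, rfl⟩
  have hzero : (μHE[J.card] : Measure (EuclideanSpace ℝ (Fin n))) (zonotope v J) = 0 := by
    refine measure_mono_null hsub ?_
    have hH : (μH[(J.card : ℝ)] : Measure W) = 0 :=
      Real.hausdorffMeasure_of_finrank_lt (by exact_mod_cast hlt)
    rw [isometry_subtype_coe.euclideanHausdorffMeasure_image,
      Measure.euclideanHausdorffMeasure_def, Measure.smul_apply, hH]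
    simp
  rw [vol, hzero, ENNReal.toReal_zero]

open Classical in
/-- The index of the lattice spanned by the `v_j`, `j ∈ J`, in `lin P_J ∩ ℤⁿ` if these vectors are
linearly independent, and `0` otherwise. -/
def latticeIndex (v : Fin m → EuclideanSpace ℝ (Fin n)) (J : Finset (Fin m)) : ℕ :=
  if LinearIndepOn ℝ v (J : Set (Fin m)) then
    (Submodule.span ℤ (v '' J)).toAddSubgroup.relIndex (linLattice (zonotope v J)).toAddSubgroup
  else 0

theorem latticeIndex_eq_vol_div_latticeDet (v : Fin m → EuclideanSpace ℝ (Fin n))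
    (hv : ∀ j, v j ∈ integerLattice n) (J : Finset (Fin m)) :
    (latticeIndex v J : ℝ) =
      vol J.card (zonotope v J) / latticeDet (linLattice (zonotope v J)) := by
  unfold latticeIndex
  split_ifs with hJ
  · exact (relIndex_eq_vol_div_latticeDet v hv J hJ).2
  · rw [vol_zonotope_of_not_linearIndepOn v J hJ, zero_div, Nat.cast_zero]

theorem latticePointCount_zonotope (v : Fin m → EuclideanSpace ℝ (Fin n))
    (hv : ∀ j, v j ∈ integerLattice n) :
    latticePointCount (zonotope v Finset.univ) =
      ∑ J ∈ (Finset.univ : Finset (Fin m)).powerset, latticeIndex v J := by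
  classical
  have h := encard_inter_sum_segment (integerLattice n) v hv Finset.univ
  rw [latticePointCount, Set.ncard, Set.inter_comm, zonotope, h]
  rw [← ENat.toNat_natCast (∑ J ∈ _, latticeIndex v J), Nat.cast_sum]
  congr 1
  refine Finset.sum_congr rfl fun J _ => ?_
  unfold latticeIndex
  split_ifs with hJ
  · have hne := (relIndex_eq_vol_div_latticeDet v hv J hJ).1
    rw [linLattice, span_zonotope] at hne ⊢
    exact classCount_eq_relIndex _ _ _ hne
  · rfl

/-! ### Dilation and the Ehrhart polynomial. -/

theorem zonotope_smul (v : Fin m → EuclideanSpace ℝ (Fin n)) (J : Finset (Fin m)) (c : ℝ) :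
    zonotope (c • v) J = c • zonotope v J := by
  have h : ∀ S : Set (EuclideanSpace ℝ (Fin n)), c • S =
      (c • LinearMap.id : EuclideanSpace ℝ (Fin n) →ₗ[ℝ] EuclideanSpace ℝ (Fin n)) '' S :=
    fun S => rfl
  rw [h, zonotope, zonotope, Set.image_finsetSum]
  refine Finset.sum_congr rfl fun j _ => ?_
  refine Eq.trans ?_ (image_segment ℝ (LinearMap.toAffineMap
    (c • LinearMap.id : EuclideanSpace ℝ (Fin n) →ₗ[ℝ] EuclideanSpace ℝ (Fin n))) 0 (v j)).symm
  simp

theorem latticeIndex_smul (v : Fin m → EuclideanSpace ℝ (Fin n))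
    (hv : ∀ j, v j ∈ integerLattice n) (J : Finset (Fin m)) (k : ℕ) :
    (latticeIndex ((k : ℝ) • v) J : ℝ) = latticeIndex v J * (k : ℝ) ^ J.card := by
  -- At `k = 0` the hull may collapse: only `J = ∅` survives, matching `0 ^ 0 = 1`. For `k ≠ 0` the
  -- hull is unchanged and only the volume scales.
  rcases eq_or_ne k 0 with rfl | hk
  · rcases J.eq_empty_or_nonempty with rfl | ⟨j, hj⟩
    · simp [latticeIndex, zonotope]
    · have hdep : ¬ LinearIndepOn ℝ (((0 : ℕ) : ℝ) • v) (J : Set (Fin m)) := fun h =>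
        h.ne_zero hj (by simp)
      rw [latticeIndex, if_neg hdep, Nat.cast_zero, zero_pow (Finset.card_ne_zero_of_mem hj),
        mul_zero]
  · have hk' : (k : ℝ) ≠ 0 := Nat.cast_ne_zero.2 hk
    have hkv : ∀ j, ((k : ℝ) • v) j ∈ integerLattice n := fun j => by
      rw [Pi.smul_apply, Nat.cast_smul_eq_nsmul]
      exact nsmul_mem (hv j) k
    have hspan : Submodule.span ℝ ((k : ℝ) • zonotope v J) = Submodule.span ℝ (zonotope v J) :=
      Submodule.span_smul_eq_of_isUnit _ _ hk'.isUnit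
    rw [latticeIndex_eq_vol_div_latticeDet _ hkv, latticeIndex_eq_vol_div_latticeDet _ hv,
      zonotope_smul, vol, Measure.euclideanHausdorffMeasure_smul₀ _ hk', linLattice, hspan,
      ← linLattice, vol, ENNReal.toReal_smul]
    rw [NNReal.smul_def, smul_eq_mul]
    simp
    ring

/-- The polynomial `∑_J [lin P_J ∩ ℤⁿ : ℤ v_J] X^#J`. -/
def indexPolynomial (v : Fin m → EuclideanSpace ℝ (Fin n)) : ℝ[X] :=
  ∑ J ∈ (Finset.univ : Finset (Fin m)).powerset, C (latticeIndex v J : ℝ) * X ^ J.card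

theorem isEhrhartPolynomial_indexPolynomial (v : Fin m → EuclideanSpace ℝ (Fin n))
    (hv : ∀ j, v j ∈ integerLattice n) :
    IsEhrhartPolynomial (zonotope v Finset.univ) (indexPolynomial v) where
  natDegree_le := by
    refine natDegree_sum_le_of_forall_le _ _ fun J _ => ?_
    -- An independent `J` has at most `n` elements; a dependent one has coefficient `0`.
    by_cases hJ : LinearIndepOn ℝ v (J : Set (Fin m))
    · refine (natDegree_C_mul_X_pow_le _ _).trans ?_
      have h := LinearIndependent.fintype_card_le_finrank hJ
      simpa using h
    · simp [latticeIndex, hJ]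
  count_eq k := by
    have hkv : ∀ j, ((k : ℝ) • v) j ∈ integerLattice n := fun j => by
      rw [Pi.smul_apply, Nat.cast_smul_eq_nsmul]
      exact nsmul_mem (hv j) k
    rw [← zonotope_smul, latticePointCount_zonotope _ hkv, indexPolynomial, eval_finsetSum,
      Nat.cast_sum]
    refine Finset.sum_congr rfl fun J _ => ?_
    rw [latticeIndex_smul v hv J k]
    simp

theorem coeff_indexPolynomial (v : Fin m → EuclideanSpace ℝ (Fin n)) (i : ℕ) :
    (indexPolynomial v).coeff i =
      ∑ J ∈ Finset.powersetCard i (Finset.univ : Finset (Fin m)), (latticeIndex v J : ℝ) := by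
  rw [indexPolynomial, finsetSum_coeff, Finset.powersetCard_eq_filter, Finset.sum_filter]
  refine Finset.sum_congr rfl fun J _ => ?_
  rw [coeff_C_mul_X_pow]
  simp only [eq_comm]

end LatticeZonotope

end

theorem mainTheorem7 (n m : ℕ) (v : Fin m → EuclideanSpace ℝ (Fin n))
    (hv : ∀ j, v j ∈ LatticeZonotope.integerLattice n) :
    LatticeZonotope.IsEhrhartPolynomial (LatticeZonotope.zonotope v Finset.univ)
        (LatticeZonotope.ehrhartPolynomial (LatticeZonotope.zonotope v Finset.univ)) ∧
      ∀ i : ℕ, 1 ≤ i → i ≤ n →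
        LatticeZonotope.ehrhartCoeff i (LatticeZonotope.zonotope v Finset.univ) =
          ∑ J ∈ Finset.powersetCard i (Finset.univ : Finset (Fin m)),
            LatticeZonotope.vol i (LatticeZonotope.zonotope v J) /
              LatticeZonotope.latticeDet
                (LatticeZonotope.linLattice (LatticeZonotope.zonotope v J)) := by
  have hp := LatticeZonotope.isEhrhartPolynomial_indexPolynomial v hv
  have hex : ∃ p, LatticeZonotope.IsEhrhartPolynomial
      (LatticeZonotope.zonotope v Finset.univ) p := ⟨_, hp⟩
  have hE : LatticeZonotope.IsEhrhartPolynomial (LatticeZonotope.zonotope v Finset.univ)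
      (LatticeZonotope.ehrhartPolynomial (LatticeZonotope.zonotope v Finset.univ)) := by
    rw [LatticeZonotope.ehrhartPolynomial, dif_pos hex]
    exact hex.choose_spec
  refine ⟨hE, fun i _ _ => ?_⟩
  rw [LatticeZonotope.ehrhartCoeff, hE.unique hp, LatticeZonotope.coeff_indexPolynomial]
  refine Finset.sum_congr rfl fun J hJ => ?_
  rw [LatticeZonotope.latticeIndex_eq_vol_div_latticeDet v hv J, (Finset.mem_powersetCard.1 hJ).2]
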